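/- Consider $N$ units with fixed real potential outcomes $Y_i(1),Y_i(0)$, $i=1,\dots,N$, and integers $N_1,N_0\ge 1$ with $N_1+N_0=N$. In a completely randomized experiment the assignment $\boldsymbol T=(T_1,\dots,T_N)\in\{0,1\}^N$ satisfies $\mathrm{pr}(\boldsymbol T=\boldsymbol t)=N_1!\,N_0!/N!$ for every $\boldsymbol t\in\{0,1\}^N$ with $\sum_i t_i=N_1$ (and probability $0$ for all other $\boldsymbol t$). Let $Y_i^{obs}=T_iY_i(1)+(1-T_i)Y_i(0)$, $\tau_i=Y_i(1)-Y_i(0)$, $\tau=N^{-1}\sum_i\tau_i$, $\bar Y_t=N^{-1}\sum_iY_i(t)$, $\widehat\tau=N_1^{-1}\sum_{i:T_i=1}Y_i^{obs}-N_0^{-1}\sum_{i:T_i=0}Y_i^{obs}$, $S_t^2=(N-1)^{-1}\sum_i\{Y_i(t)-\bar Y_t\}^2$ for $t=0,1$, and $S_\tau^2=(N-1)^{-1}\sum_i(\tau_i-\tau)^2$. Then $$E(\widehat\tau)=\tau,\qquad \mathrm{var}(\widehat\tau)=\frac{S_1^2}{N_1}+\frac{S_0^2}{N_0}-\frac{S_\tau^2}{N}.$$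 Moreover, consider a sequence of completely randomized experiments whose sizes satisfy $N\to\infty$ (all quantities above depend on the index of the sequence) with $N_1/N\to c$ for some $c\in(0,1)$. Put $x_i=Y_i(1)/N_1+Y_i(0)/N_0$ and $\bar x=N^{-1}\sum_ix_i$, and suppose that, for all sufficiently large indices of the sequence, $\sum_i(x_i-\bar x)^2>0$ and the ratio $$\frac{\max_{1\le i\le N}(x_i-\bar x)^2}{\sum_{i=1}^N(x_i-\bar x)^2/N}$$ is bounded by a constant not depending on the index. Then $$\frac{\widehat\tau-\tau}{\sqrt{\mathrm{var}(\widehat\tau)}}\ \stackrel{d}{\longrightarrow}\ \mathcal N(0,1).$$ -/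

import Mathlib

open MeasureTheory ProbabilityTheory Filter Topology
open scoped Nat

noncomputable section

/-- A treatment assignment vector in `{0, 1}^N`; `1` is treatment and `0` is control. -/
abbrev Assignment (N : ℕ) : Type := Fin N → Fin 2

/-- The potential outcomes of `N` units: `Y i a` is the outcome of unit `i` under treatment `a`. -/
abbrev PotentialOutcomes (N : ℕ) : Type := Fin N → Fin 2 → ℝ

/-- The random assignment `T` on `(Ω, P)` is completely randomized with `N₁` treated units:
`pr (T = t) = N₁! N₀! / N!` if `t` has exactly `N₁` treated units (`N₀ = N - N₁`), and no other
assignment has positive probability. -/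
structure IsCompletelyRandomized {N : ℕ} (N₁ : ℕ) {Ω : Type*} [MeasurableSpace Ω]
    (T : Ω → Assignment N) (P : Measure Ω) : Prop where
  measurable : Measurable T
  law : ∀ t : Assignment N, P.real {ω | T ω = t} =
    if ∑ i, (t i : ℕ) = N₁ then ((N₁ ! : ℝ) * ((N - N₁)! : ℝ)) / (N ! : ℝ) else 0

/-- The number of units in the arm `a`: `N₁` for treatment and `N₀ = N - N₁` for control. -/
def armSize (N N₁ : ℕ) (a : Fin 2) : ℕ := if a = 1 then N₁ else N - N₁

/-- The average of the real numbers `c 1, …, c N`. -/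
def popMean {N : ℕ} (c : Fin N → ℝ) : ℝ := (∑ i, c i) / N

/-- The finite population variance of `c 1, …, c N`, with divisor `N - 1`. -/
def popVar {N : ℕ} (c : Fin N → ℝ) : ℝ := (∑ i, (c i - popMean c) ^ 2) / ((N : ℝ) - 1)

/-- The individual causal effect `τ_i = Y_i(1) - Y_i(0)`. -/
def indivEffect {N : ℕ} (Y : PotentialOutcomes N) (i : Fin N) : ℝ := Y i 1 - Y i 0

/-- The average causal effect `τ`. -/
def avgEffect {N : ℕ} (Y : PotentialOutcomes N) : ℝ := popMean (indivEffect Y)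

/-- The observed outcome `Y_i^obs = t_i Y_i(1) + (1 - t_i) Y_i(0)` under the assignment `t`. -/
def obsOutcome {N : ℕ} (Y : PotentialOutcomes N) (t : Assignment N) (i : Fin N) : ℝ :=
  ((t i : ℕ) : ℝ) * Y i 1 + (1 - ((t i : ℕ) : ℝ)) * Y i 0

/-- The sample mean of the observed outcomes in the arm `a`. -/
def armMean {N : ℕ} (N₁ : ℕ) (Y : PotentialOutcomes N) (t : Assignment N) (a : Fin 2) : ℝ :=
  (∑ i with t i = a, obsOutcome Y t i) / (armSize N N₁ a : ℝ)

/-- The difference-in-means estimator `τ̂` as a function of the assignment. -/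
def tauHat {N : ℕ} (N₁ : ℕ) (Y : PotentialOutcomes N) (t : Assignment N) : ℝ :=
  armMean N₁ Y t 1 - armMean N₁ Y t 0

/-- The numbers `x_i = Y_i(1) / N₁ + Y_i(0) / N₀`. -/
def weightedOutcome {N : ℕ} (N₁ : ℕ) (Y : PotentialOutcomes N) (i : Fin N) : ℝ :=
  Y i 1 / (armSize N N₁ 1 : ℝ) + Y i 0 / (armSize N N₁ 0 : ℝ)

/-- The ratio `max_i (x_i - x̄)² / (∑_i (x_i - x̄)² / N)`. -/
def hajekRatio {N : ℕ} (x : Fin N → ℝ) : ℝ :=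
  (⨆ i, (x i - popMean x) ^ 2) / ((∑ i, (x i - popMean x) ^ 2) / N)

/-- Along a sequence of finite populations `x k`, the Hájek ratio is (eventually) well defined,
that is, has a nonzero denominator, and bounded. -/
def HajekCondition {N : ℕ → ℕ} (x : ∀ k, Fin (N k) → ℝ) : Prop :=
  ∃ B : ℝ, ∀ᶠ k in atTop,
    0 < ∑ i, (x k i - popMean (x k)) ^ 2 ∧ hajekRatio (x k) ≤ B

end

/-!
On the assignments with `N₁` treated units, `τ̂ - τ` is the linear statistic `∑ i, t i * (x i - x̄)`
with `x i = Y i 1 / N₁ + Y i 0 / N₀` (`tauHat_sub_avgEffect`). The weights have sum zero, so the mean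
is `0`, and the variance is a multiple of `∑ i, (x i - x̄) ^ 2`, because exchangeability and the
constraint `∑ i, t i = N₁` determine the first two moments of the assignment
(`IsCompletelyRandomized.integral_treated_mul_treated`). Expanding the square unit by unit gives the
three finite population variances (`sum_sq_weightedOutcome_eq`).

Asymptotic normality follows the characteristic function method of Erdős and Rényi. A completely
randomized assignment is a vector of independent Bernoulli variables of parameter `p = N₁ / N`
conditioned on its sum, and Fourier inversion in the sum gives, for `∑ j, s j = 0`,
`E exp (i ∑ j, T j * s j) = J s / J 0` with `J s = ∫ θ in -π..π, ∏ j, g (θ + s j)`, where `g` is the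
characteristic function of a centred Bernoulli variable
(`IsCompletelyRandomized.integral_exp_linear`). Taking a ratio removes all combinatorial constants,
so that Stirling's formula is not needed.

Write `σ = √(N p (1 - p))`, `s j = d j / σ` and `θ = v / σ`. Then `∏ j, g ((v + d j) / σ)` is close to
`∏ j, exp (-(v + d j) ^ 2 / (2 N)) = exp (-(v ^ 2 + (∑ j, d j ^ 2) / N) / 2)` when the `d j` are
bounded, and it is dominated by a Gaussian on the whole range of integration
(`norm_prod_bernoulliCharFun_sub_le`, `norm_prod_bernoulliCharFun_le`). Dominated convergence shows
that the ratio tends to `exp (-V / 2)` with `V = lim (∑ j, d j ^ 2) / N`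
(`tendsto_fourierIntegral_div`). For the standardized estimator at the frequency `u`, the bound on the
Hájek ratio is what bounds the `d j`, and `V = u ^ 2`. Lévy's continuity theorem concludes.
-/

/-! ### Moments of a completely randomized assignment -/

namespace IsCompletelyRandomized

variable {N N₁ : ℕ} {Ω : Type*} [MeasurableSpace Ω] {P : Measure Ω} {T : Ω → Assignment N}

theorem integral_comp_eq_smul_sum {E : Type*} [NormedAddCommGroup E] [NormedSpace ℝ E]
    [CompleteSpace E] [IsFiniteMeasure P] (h : IsCompletelyRandomized N₁ T P)
    (f : Assignment N → E) :
    ∫ ω, f (T ω) ∂P = (((N₁ ! : ℝ) * ((N - N₁)! : ℝ)) / (N ! : ℝ)) •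
      ∑ t : Assignment N with ∑ i, (t i : ℕ) = N₁, f t := by
  have hmap : ∫ ω, f (T ω) ∂P = ∫ t, f t ∂(P.map T) :=
    (integral_map h.measurable.aemeasurable
      StronglyMeasurable.of_discrete.aestronglyMeasurable).symm
  rw [hmap, integral_fintype .of_finite, Finset.smul_sum, Finset.sum_filter]
  refine Finset.sum_congr rfl fun t _ => ?_
  have hT : (P.map T).real {t} = P.real {ω | T ω = t} := by
    rw [map_measureReal_apply h.measurable (measurableSet_singleton t)]
    rfl
  rw [hT, h.law t]
  split_ifs <;> simp

/-- Two functions that agree on the assignments with `N₁` treated units have the same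
expectation. -/
theorem integral_comp_congr {E : Type*} [NormedAddCommGroup E] [NormedSpace ℝ E]
    [CompleteSpace E] [IsFiniteMeasure P] (h : IsCompletelyRandomized N₁ T P)
    {f g : Assignment N → E} (hfg : ∀ t, ∑ i, (t i : ℕ) = N₁ → f t = g t) :
    ∫ ω, f (T ω) ∂P = ∫ ω, g (T ω) ∂P := by
  rw [h.integral_comp_eq_smul_sum, h.integral_comp_eq_smul_sum]
  congr 1
  exact Finset.sum_congr rfl fun t ht => hfg t (Finset.mem_filter.1 ht).2

/-- The law of a completely randomized assignment is invariant under relabelling the units. -/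
theorem integral_comp_perm {E : Type*} [NormedAddCommGroup E] [NormedSpace ℝ E]
    [CompleteSpace E] [IsFiniteMeasure P] (h : IsCompletelyRandomized N₁ T P)
    (f : Assignment N → E) (σ : Equiv.Perm (Fin N)) :
    ∫ ω, f (T ω ∘ σ) ∂P = ∫ ω, f (T ω) ∂P := by
  rw [h.integral_comp_eq_smul_sum (fun t => f (t ∘ σ)), h.integral_comp_eq_smul_sum]
  congr 1
  refine Finset.sum_equiv (Equiv.arrowCongr σ.symm (Equiv.refl (Fin 2))) (fun t => ?_)
    (fun t _ => ?_)
  · simp only [Finset.mem_filter, Finset.mem_univ, true_and, Equiv.arrowCongr_apply,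
      Equiv.symm_symm, Equiv.coe_refl, Function.comp_apply, id_eq]
    rw [Equiv.sum_comp σ (fun i => (t i : ℕ))]
  · rfl

theorem integrable_comp {E : Type*} [NormedAddCommGroup E] [IsFiniteMeasure P]
    (h : IsCompletelyRandomized N₁ T P) (f : Assignment N → E) :
    Integrable (fun ω => f (T ω)) P :=
  Integrable.comp_measurable (f := T) (g := f) (.of_finite) h.measurable

theorem memLp_comp [IsFiniteMeasure P] (h : IsCompletelyRandomized N₁ T P)
    (f : Assignment N → ℝ) (p : ENNReal) : MemLp (fun ω => f (T ω)) p P :=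
  MemLp.of_bound ((measurable_of_finite f).comp h.measurable).aestronglyMeasurable ‖f‖
    (.of_forall fun ω => norm_le_pi_norm f (T ω))

variable [IsProbabilityMeasure P]

theorem integral_treated (h : IsCompletelyRandomized N₁ T P) (i : Fin N) :
    ∫ ω, ((T ω i : ℕ) : ℝ) ∂P = (N₁ : ℝ) / N := by
  have hN : (N : ℝ) ≠ 0 := by
    have := i.pos
    positivity
  have hsym (j : Fin N) : ∫ ω, ((T ω j : ℕ) : ℝ) ∂P = ∫ ω, ((T ω i : ℕ) : ℝ) ∂P := by
    rw [← h.integral_comp_perm (fun t => ((t i : ℕ) : ℝ)) (Equiv.swap i j)]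
    simp
  have hsum : ∑ j, ∫ ω, ((T ω j : ℕ) : ℝ) ∂P = N₁ := by
    rw [← integral_finsetSum _ fun j _ => h.integrable_comp (fun t => ((t j : ℕ) : ℝ)),
      h.integral_comp_congr (f := fun t => ∑ j, ((t j : ℕ) : ℝ)) (g := fun _ => (N₁ : ℝ))
        (fun t ht => by exact_mod_cast ht)]
    simp
  simp only [hsym, Finset.sum_const, Finset.card_univ, Fintype.card_fin, nsmul_eq_mul] at hsum
  field_simp
  linarith

theorem integral_treated_mul_self (h : IsCompletelyRandomized N₁ T P) (i : Fin N) :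
    ∫ ω, ((T ω i : ℕ) : ℝ) * ((T ω i : ℕ) : ℝ) ∂P = (N₁ : ℝ) / N := by
  rw [← h.integral_treated i]
  refine integral_congr_ae (.of_forall fun ω => ?_)
  have hcases (a : Fin 2) : ((a : ℕ) : ℝ) * ((a : ℕ) : ℝ) = ((a : ℕ) : ℝ) := by
    fin_cases a <;> simp
  exact hcases _

/-- Only the exchangeability of the units and the identity `∑ l, T l = N₁` are used, no count of
assignments. -/
theorem integral_treated_mul_treated (h : IsCompletelyRandomized N₁ T P) {i j : Fin N}
    (hij : i ≠ j) :
    ∫ ω, ((T ω i : ℕ) : ℝ) * ((T ω j : ℕ) : ℝ) ∂P =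
      ((N₁ : ℝ) * (N₁ - 1)) / (N * (N - 1)) := by
  have hN2 : (2 : ℝ) ≤ N := by
    have h1 := i.isLt
    have h2 := j.isLt
    have h3 : (i : ℕ) ≠ j := fun h => hij (Fin.ext h)
    exact_mod_cast (by omega : 2 ≤ N)
  have hN : (N : ℝ) ≠ 0 := by linarith
  have hN' : (N : ℝ) - 1 ≠ 0 := by linarith
  have hsym (l : Fin N) (hl : l ∈ Finset.univ.erase i) :
      ∫ ω, ((T ω i : ℕ) : ℝ) * ((T ω l : ℕ) : ℝ) ∂P =
        ∫ ω, ((T ω i : ℕ) : ℝ) * ((T ω j : ℕ) : ℝ) ∂P := by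
    rw [← h.integral_comp_perm (fun t => ((t i : ℕ) : ℝ) * ((t j : ℕ) : ℝ)) (Equiv.swap j l)]
    simp [Equiv.swap_apply_of_ne_of_ne hij (Finset.ne_of_mem_erase hl).symm]
  -- `∑ l, T l = N₁`, so multiplying by `T i` and taking expectations gives a linear equation.
  have hsum : ∑ l, ∫ ω, ((T ω i : ℕ) : ℝ) * ((T ω l : ℕ) : ℝ) ∂P = N₁ * ((N₁ : ℝ) / N) := by
    rw [← integral_finsetSum _ fun l _ =>
        h.integrable_comp (fun t => ((t i : ℕ) : ℝ) * ((t l : ℕ) : ℝ)),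
      h.integral_comp_congr (f := fun t => ∑ l, ((t i : ℕ) : ℝ) * ((t l : ℕ) : ℝ))
        (g := fun t => (N₁ : ℝ) * ((t i : ℕ) : ℝ)) (fun t ht => ?_), integral_const_mul,
      h.integral_treated i]
    rw [← Finset.mul_sum, mul_comm]
    congr 1
    exact_mod_cast ht
  rw [← Finset.add_sum_erase _ _ (Finset.mem_univ i), h.integral_treated_mul_self,
    Finset.sum_congr rfl hsym, Finset.sum_const, Finset.card_erase_of_mem (Finset.mem_univ i),
    Finset.card_univ,
    Fintype.card_fin, nsmul_eq_mul, Nat.cast_sub (by exact_mod_cast (by linarith : (1 : ℝ) ≤ N)),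
    Nat.cast_one] at hsum
  rw [eq_div_iff (mul_ne_zero hN hN')]
  field_simp at hsum
  linarith

theorem integral_linear_eq_zero (h : IsCompletelyRandomized N₁ T P) {b : Fin N → ℝ}
    (hb : ∑ i, b i = 0) : ∫ ω, ∑ i, ((T ω i : ℕ) : ℝ) * b i ∂P = 0 := by
  rw [integral_finsetSum _ fun i _ => h.integrable_comp (fun t => ((t i : ℕ) : ℝ) * b i)]
  simp [integral_mul_const, h.integral_treated, ← Finset.mul_sum, hb]

theorem integral_linear_sq (h : IsCompletelyRandomized N₁ T P) (hN : 2 ≤ N) {b : Fin N → ℝ}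
    (hb : ∑ i, b i = 0) :
    ∫ ω, (∑ i, ((T ω i : ℕ) : ℝ) * b i) ^ 2 ∂P =
      (N₁ : ℝ) * (N - N₁) / (N * (N - 1)) * ∑ i, b i ^ 2 := by
  have hN2 : (2 : ℝ) ≤ N := by exact_mod_cast hN
  have hN0 : (N : ℝ) ≠ 0 := by linarith
  have hN' : (N : ℝ) - 1 ≠ 0 := by linarith
  have hterm (i j : Fin N) :
      ∫ ω, (((T ω i : ℕ) : ℝ) * b i) * (((T ω j : ℕ) : ℝ) * b j) ∂P =
        ((N₁ : ℝ) * (N₁ - 1)) / (N * (N - 1)) * (b i * b j) +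
          if i = j then (N₁ : ℝ) * (N - N₁) / (N * (N - 1)) * b i ^ 2 else 0 := by
    simp_rw [mul_mul_mul_comm _ (b i), integral_mul_const]
    split_ifs with hij
    · subst hij
      rw [h.integral_treated_mul_self]
      field_simp
      ring
    · rw [h.integral_treated_mul_treated hij, add_zero]
  simp_rw [pow_two (∑ i, _), Finset.sum_mul_sum]
  rw [integral_finsetSum _ fun i _ => h.integrable_comp
    (fun t => ∑ j, (((t i : ℕ) : ℝ) * b i) * (((t j : ℕ) : ℝ) * b j))]
  have hinner (i : Fin N) :
      ∫ ω, ∑ j, (((T ω i : ℕ) : ℝ) * b i) * (((T ω j : ℕ) : ℝ) * b j) ∂P =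
        (N₁ : ℝ) * (N - N₁) / (N * (N - 1)) * b i ^ 2 := by
    rw [integral_finsetSum _ fun j _ => h.integrable_comp
      (fun t => (((t i : ℕ) : ℝ) * b i) * (((t j : ℕ) : ℝ) * b j))]
    simp_rw [hterm, Finset.sum_add_distrib, ← Finset.mul_sum, hb]
    simp
  simp_rw [hinner, Finset.mul_sum]

end IsCompletelyRandomized

/-! ### The difference in means as a linear statistic -/

theorem sum_sub_popMean {N : ℕ} (c : Fin N → ℝ) : ∑ i, (c i - popMean c) = 0 := by
  rcases Nat.eq_zero_or_pos N with rfl | hN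
  · simp
  · have : (N : ℝ) ≠ 0 := by positivity
    simp only [popMean, Finset.sum_sub_distrib, Finset.sum_const, Finset.card_univ,
      Fintype.card_fin, nsmul_eq_mul]
    field_simp
    ring

theorem tauHat_sub_avgEffect {N N₁ : ℕ} (Y : PotentialOutcomes N) (h0 : 0 < N₁) (h1 : N₁ < N)
    {t : Assignment N} (ht : ∑ i, (t i : ℕ) = N₁) :
    tauHat N₁ Y t - avgEffect Y = ∑ i, ((t i : ℕ) : ℝ) *
      (weightedOutcome N₁ Y i - popMean (weightedOutcome N₁ Y)) := by
  have hN₁ : (N₁ : ℝ) ≠ 0 := by positivity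
  have hN : (N : ℝ) ≠ 0 := by
    have := h0.trans h1
    positivity
  have hN₀ : (N : ℝ) - N₁ ≠ 0 := sub_ne_zero.2 (by exact_mod_cast h1.ne')
  have ht' : ∑ i, ((t i : ℕ) : ℝ) = N₁ := by exact_mod_cast ht
  have harm1 : ∑ i with t i = 1, obsOutcome Y t i = ∑ i, ((t i : ℕ) : ℝ) * Y i 1 := by
    rw [Finset.sum_filter]
    refine Finset.sum_congr rfl fun i _ => ?_
    unfold obsOutcome
    generalize t i = a
    fin_cases a <;> simp
  have harm0 : ∑ i with t i = 0, obsOutcome Y t i =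
      ∑ i, Y i 0 - ∑ i, ((t i : ℕ) : ℝ) * Y i 0 := by
    rw [Finset.sum_filter, ← Finset.sum_sub_distrib]
    refine Finset.sum_congr rfl fun i _ => ?_
    unfold obsOutcome
    generalize t i = a
    fin_cases a <;> simp
  simp only [tauHat, armMean, harm1, harm0, avgEffect, popMean, indivEffect, weightedOutcome,
    armSize, mul_sub, mul_add, Finset.sum_sub_distrib, Finset.sum_add_distrib, ← Finset.sum_mul,
    ht', mul_div_assoc', ← Finset.sum_div, if_true, zero_ne_one, if_false, Nat.cast_sub h1.le]
  field_simp
  ring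

/-- The variance of the linear statistic, expressed through the three finite population
variances. -/
theorem sum_sq_weightedOutcome_eq {N N₁ : ℕ} (Y : PotentialOutcomes N) (h0 : 0 < N₁)
    (h1 : N₁ < N) :
    (N₁ : ℝ) * (N - N₁) / (N * (N - 1)) *
        ∑ i, (weightedOutcome N₁ Y i - popMean (weightedOutcome N₁ Y)) ^ 2 =
      popVar (fun i => Y i 1) / (armSize N N₁ 1 : ℝ) +
        popVar (fun i => Y i 0) / (armSize N N₁ 0 : ℝ) - popVar (indivEffect Y) / (N : ℝ) := by
  have hN₁ : (N₁ : ℝ) ≠ 0 := by positivity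
  have hN : (N : ℝ) ≠ 0 := by
    have := h0.trans h1
    positivity
  have hN' : (N : ℝ) - 1 ≠ 0 := sub_ne_zero.2 (by exact_mod_cast (by omega : N ≠ 1))
  have hN₀ : (N : ℝ) - N₁ ≠ 0 := sub_ne_zero.2 (by exact_mod_cast h1.ne')
  have hmean : popMean (weightedOutcome N₁ Y) =
      popMean (fun i => Y i 1) / N₁ + popMean (fun i => Y i 0) / (N - N₁) := by
    simp only [popMean, weightedOutcome, armSize, Finset.sum_add_distrib, ← Finset.sum_div,
      if_true, zero_ne_one, if_false, Nat.cast_sub h1.le]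
    field_simp
  have hmeanτ : popMean (indivEffect Y) =
      popMean (fun i => Y i 1) - popMean (fun i => Y i 0) := by
    simp only [popMean, indivEffect, Finset.sum_sub_distrib, sub_div]
  simp only [popVar, hmean, hmeanτ, Finset.mul_sum, Finset.sum_div, ← Finset.sum_add_distrib,
    ← Finset.sum_sub_distrib]
  refine Finset.sum_congr rfl fun i _ => ?_
  simp only [indivEffect, weightedOutcome, armSize, if_true, zero_ne_one, if_false,
    Nat.cast_sub h1.le]
  field_simp
  ring

namespace IsCompletelyRandomized

variable {N N₁ : ℕ} {Ω : Type*} [MeasurableSpace Ω] {P : Measure Ω} [IsProbabilityMeasure P]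
  {T : Ω → Assignment N}

theorem integral_tauHat (h : IsCompletelyRandomized N₁ T P) (Y : PotentialOutcomes N)
    (h0 : 0 < N₁) (h1 : N₁ < N) : ∫ ω, tauHat N₁ Y (T ω) ∂P = avgEffect Y := by
  rw [← sub_eq_zero]
  calc ∫ ω, tauHat N₁ Y (T ω) ∂P - avgEffect Y
      = ∫ ω, (tauHat N₁ Y (T ω) - avgEffect Y) ∂P := by
        rw [integral_sub (h.integrable_comp _) (integrable_const _)]
        simp
    _ = ∫ ω, ∑ i, ((T ω i : ℕ) : ℝ) *
          (weightedOutcome N₁ Y i - popMean (weightedOutcome N₁ Y)) ∂P :=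
        h.integral_comp_congr (f := fun t => tauHat N₁ Y t - avgEffect Y)
          fun t ht => tauHat_sub_avgEffect Y h0 h1 ht
    _ = 0 := h.integral_linear_eq_zero (sum_sub_popMean _)

theorem variance_tauHat (h : IsCompletelyRandomized N₁ T P) (Y : PotentialOutcomes N)
    (h0 : 0 < N₁) (h1 : N₁ < N) :
    variance (fun ω => tauHat N₁ Y (T ω)) P = (N₁ : ℝ) * (N - N₁) / (N * (N - 1)) *
      ∑ i, (weightedOutcome N₁ Y i - popMean (weightedOutcome N₁ Y)) ^ 2 := by
  rw [variance_eq_integral (h.integrable_comp _).aestronglyMeasurable.aemeasurable,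
    h.integral_tauHat Y h0 h1,
    ← h.integral_linear_sq (by omega) (sum_sub_popMean (weightedOutcome N₁ Y))]
  exact h.integral_comp_congr (f := fun t => (tauHat N₁ Y t - avgEffect Y) ^ 2)
    (g := fun t => (∑ i, ((t i : ℕ) : ℝ) *
      (weightedOutcome N₁ Y i - popMean (weightedOutcome N₁ Y))) ^ 2)
    fun t ht => by rw [tauHat_sub_avgEffect Y h0 h1 ht]

end IsCompletelyRandomized

/-! ### Conditioned Bernoulli sampling and Fourier inversion -/

/-- The characteristic function of a centred Bernoulli variable of parameter `p`. -/
noncomputable def bernoulliCharFun (p x : ℝ) : ℂ :=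
  (1 - p) * Complex.exp (-(p * x) * Complex.I) + p * Complex.exp ((1 - p) * x * Complex.I)

@[fun_prop]
theorem continuous_bernoulliCharFun (p : ℝ) : Continuous (bernoulliCharFun p) := by
  unfold bernoulliCharFun
  fun_prop

/-- The integral over `θ` of the joint characteristic function of the sample size `∑ j, (t j - p)`
and of `∑ j, (t j - p) * s j`, for independent Bernoulli variables `t j` of parameter `p`. It is a
Fourier coefficient in `θ`, which restricts the second sum to the samples of size `N p`; see
`fourierIntegral_eq_sum`. -/
noncomputable def fourierIntegral {N : ℕ} (p : ℝ) (s : Fin N → ℝ) : ℂ :=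
  ∫ θ in (-Real.pi)..Real.pi, ∏ j, bernoulliCharFun p (θ + s j)

theorem integral_exp_int_mul_I (n : ℤ) :
    ∫ θ in (-Real.pi)..Real.pi, Complex.exp (n * θ * Complex.I) =
      if n = 0 then 2 * (Real.pi : ℂ) else 0 := by
  split_ifs with hn
  · subst hn
    simp
    ring
  · have hc : (n : ℂ) * Complex.I ≠ 0 := mul_ne_zero (by exact_mod_cast hn) Complex.I_ne_zero
    have hper : Complex.exp (n * Complex.I * (Real.pi : ℝ)) =
        Complex.exp (n * Complex.I * ((-Real.pi : ℝ) : ℂ)) := by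
      rw [Complex.exp_eq_exp_iff_exists_int]
      exact ⟨n, by push_cast; ring⟩
    simp_rw [mul_right_comm (n : ℂ) _ Complex.I]
    rw [integral_exp_mul_complex hc, hper, sub_self, zero_div]

theorem prod_bernoulliCharFun_eq_sum {N N₁ : ℕ} {p : ℝ} (hp : N * p = N₁) {s : Fin N → ℝ}
    (hs : ∑ j, s j = 0) (θ : ℝ) :
    ∏ j, bernoulliCharFun p (θ + s j) = ∑ t : Assignment N,
      ((p : ℂ) ^ (∑ j, (t j : ℕ)) * (1 - p) ^ (N - ∑ j, (t j : ℕ)) *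
        Complex.exp ((∑ j, ((t j : ℕ) : ℝ) * s j : ℝ) * Complex.I)) *
      Complex.exp (((∑ j, (t j : ℕ) : ℕ) - N₁ : ℤ) * θ * Complex.I) := by
  have hfactor (j : Fin N) : bernoulliCharFun p (θ + s j) = ∑ a : Fin 2,
      ((p : ℂ) ^ (a : ℕ) * (1 - p) ^ (1 - (a : ℕ))) *
        Complex.exp ((((a : ℕ) : ℝ) - p : ℝ) * (θ + s j) * Complex.I) := by
    simp [bernoulliCharFun, Fin.sum_univ_two]
  simp_rw [hfactor]
  rw [Finset.prod_univ_sum, Fintype.piFinset_univ]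
  refine Finset.sum_congr rfl fun t _ => ?_
  have hcard : ∑ j, (1 - (t j : ℕ)) = N - ∑ j, (t j : ℕ) := by
    have : ∑ j, (1 - (t j : ℕ)) + ∑ j, (t j : ℕ) = N := by
      rw [← Finset.sum_add_distrib, Finset.sum_congr rfl
        fun j _ => Nat.sub_add_cancel (by omega : (t j : ℕ) ≤ 1)]
      simp
    omega
  rw [Finset.prod_mul_distrib, Finset.prod_mul_distrib, Finset.prod_pow_eq_pow_sum,
    Finset.prod_pow_eq_pow_sum, hcard, ← Complex.exp_sum, mul_assoc _ (Complex.exp _),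
    ← Complex.exp_add]
  congr 2
  rw [← Finset.sum_mul, ← add_mul]
  congr 1
  have hreal : ∑ j, (((t j : ℕ) : ℝ) - p) * (θ + s j) =
      ∑ j, ((t j : ℕ) : ℝ) * s j + (∑ j, ((t j : ℕ) : ℝ) - N₁) * θ := by
    simp only [sub_mul, mul_add, Finset.sum_sub_distrib, Finset.sum_add_distrib,
      ← Finset.mul_sum, ← Finset.sum_mul, hs, Finset.sum_const, Finset.card_univ,
      Fintype.card_fin, nsmul_eq_mul, ← hp]
    ring
  exact_mod_cast congrArg (fun r : ℝ => (r : ℂ)) hreal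

theorem fourierIntegral_eq_sum {N N₁ : ℕ} {p : ℝ} (hp : N * p = N₁) {s : Fin N → ℝ}
    (hs : ∑ j, s j = 0) :
    fourierIntegral p s = (2 * Real.pi * (p : ℂ) ^ N₁ * (1 - p) ^ (N - N₁)) *
      ∑ t : Assignment N with ∑ i, (t i : ℕ) = N₁,
        Complex.exp ((∑ j, ((t j : ℕ) : ℝ) * s j : ℝ) * Complex.I) := by
  unfold fourierIntegral
  simp_rw [prod_bernoulliCharFun_eq_sum hp hs]
  rw [intervalIntegral.integral_finsetSum fun t _ =>
    Continuous.intervalIntegrable (by fun_prop) _ _]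
  simp_rw [intervalIntegral.integral_const_mul, integral_exp_int_mul_I]
  rw [Finset.mul_sum, Finset.sum_filter]
  refine Finset.sum_congr rfl fun t _ => ?_
  by_cases ht : ∑ i, (t i : ℕ) = N₁
  · rw [if_pos ht, ht, if_pos (sub_self _)]
    ring
  · rw [if_neg ht, if_neg (by rw [sub_eq_zero]; exact_mod_cast ht), mul_zero]

/-- Erdős–Rényi formula for the characteristic function of a linear statistic of a simple random
sample. -/
theorem IsCompletelyRandomized.integral_exp_linear {N N₁ : ℕ} {Ω : Type*} [MeasurableSpace Ω]
    {P : Measure Ω} [IsProbabilityMeasure P] {T : Ω → Assignment N}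
    (h : IsCompletelyRandomized N₁ T P) (h0 : 0 < N₁) (h1 : N₁ < N) {s : Fin N → ℝ}
    (hs : ∑ j, s j = 0) :
    ∫ ω, Complex.exp ((∑ j, ((T ω j : ℕ) : ℝ) * s j : ℝ) * Complex.I) ∂P =
      fourierIntegral ((N₁ : ℝ) / N) s / fourierIntegral ((N₁ : ℝ) / N) (fun _ : Fin N => 0) := by
  have hN : (N : ℝ) ≠ 0 := by
    have := h0.trans h1
    positivity
  have hp : (N : ℝ) * ((N₁ : ℝ) / N) = N₁ := mul_div_cancel₀ _ hN
  have hp0 : (((N₁ : ℝ) / N : ℝ) : ℂ) ≠ 0 := by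
    rw [Complex.ofReal_ne_zero]
    positivity
  have hp1 : 1 - (((N₁ : ℝ) / N : ℝ) : ℂ) ≠ 0 := by
    rw [sub_ne_zero, ← Complex.ofReal_one, Ne, Complex.ofReal_inj, eq_comm, div_eq_one_iff_eq hN]
    exact_mod_cast h1.ne
  have hpi : (Real.pi : ℂ) ≠ 0 := by exact_mod_cast Real.pi_ne_zero
  -- The constant `N₁! N₀! / N!` is eliminated by taking the expectation of `1`.
  have hone := h.integral_comp_eq_smul_sum (fun _ => (1 : ℂ))
  rw [integral_const, probReal_univ, one_smul] at hone
  rw [h.integral_comp_eq_smul_sum (fun t : Assignment N =>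
    Complex.exp ((∑ j, ((t j : ℕ) : ℝ) * s j : ℝ) * Complex.I)),
    fourierIntegral_eq_sum hp hs, fourierIntegral_eq_sum hp (by simp)]
  simp only [Complex.real_smul, mul_zero, Finset.sum_const_zero, Complex.ofReal_zero, zero_mul,
    Complex.exp_zero] at hone ⊢
  rw [mul_div_mul_left _ _ (mul_ne_zero (mul_ne_zero (mul_ne_zero two_ne_zero hpi)
      (pow_ne_zero _ hp0)) (pow_ne_zero _ hp1)), eq_div_iff (right_ne_zero_of_mul_eq_one hone.symm),
    mul_right_comm, ← hone, one_mul]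

/-! ### Bounds for the characteristic function of a centred Bernoulli variable -/

theorem norm_exp_mul_I_sub_taylor_le {y : ℝ} (hy : |y| ≤ 1) :
    ‖Complex.exp (y * Complex.I) - (1 + y * Complex.I - (y : ℂ) ^ 2 / 2)‖ ≤ |y| ^ 3 / 4 := by
  have hnorm : ‖(y : ℂ) * Complex.I‖ = |y| := by simp
  have h := Complex.exp_bound (x := y * Complex.I) (by rwa [hnorm]) (n := 3) (by norm_num)
  have hsum : ∑ m ∈ Finset.range 3, ((y : ℂ) * Complex.I) ^ m / (m ! : ℂ) =
      1 + y * Complex.I - (y : ℂ) ^ 2 / 2 := by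
    simp [Finset.sum_range_succ, mul_pow, Nat.factorial]
    ring
  rw [hsum, hnorm] at h
  refine h.trans ?_
  have h3 : 0 ≤ |y| ^ 3 := by positivity
  norm_num [Nat.factorial]
  linarith

theorem norm_bernoulliCharFun_sub_exp_le {p x : ℝ} (hp0 : 0 ≤ p) (hp1 : p ≤ 1) (hx : |x| ≤ 1) :
    ‖bernoulliCharFun p x - (Real.exp (-(p * (1 - p) * x ^ 2 / 2)) : ℝ)‖ ≤ |x| ^ 3 := by
  have hax := abs_nonneg x
  have hx3 : 0 ≤ |x| ^ 3 := by positivity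
  have hpq : p * (1 - p) ≤ 1 / 4 := by nlinarith [sq_nonneg (p - 1 / 2)]
  have hpq0 : 0 ≤ p * (1 - p) := mul_nonneg hp0 (by linarith)
  -- Taylor expansions of order two; their combination has no linear term, and `-p (1 - p) x² / 2`
  -- as quadratic term.
  have hA : ‖Complex.exp ((-(p * x) : ℝ) * Complex.I) -
      (1 + (-(p * x) : ℝ) * Complex.I - ((-(p * x) : ℝ) : ℂ) ^ 2 / 2)‖ ≤ |x| ^ 3 / 4 := by
    have hle : |-(p * x)| ≤ |x| := by
      rw [abs_neg, abs_mul, abs_of_nonneg hp0]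
      exact mul_le_of_le_one_left hax hp1
    refine (norm_exp_mul_I_sub_taylor_le (hle.trans hx)).trans ?_
    gcongr
  have hB : ‖Complex.exp (((1 - p) * x : ℝ) * Complex.I) -
      (1 + ((1 - p) * x : ℝ) * Complex.I - (((1 - p) * x : ℝ) : ℂ) ^ 2 / 2)‖ ≤ |x| ^ 3 / 4 := by
    have hle : |(1 - p) * x| ≤ |x| := by
      rw [abs_mul, abs_of_nonneg (by linarith : 0 ≤ 1 - p)]
      exact mul_le_of_le_one_left hax (by linarith)
    refine (norm_exp_mul_I_sub_taylor_le (hle.trans hx)).trans ?_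
    gcongr
  have hC : |Real.exp (-(p * (1 - p) * x ^ 2 / 2)) - 1 - -(p * (1 - p) * x ^ 2 / 2)| ≤
      |x| ^ 3 / 4 := by
    have hx2 : x ^ 2 ≤ 1 := by rw [← sq_abs]; exact pow_le_one₀ hax hx
    have hy : |-(p * (1 - p) * x ^ 2 / 2)| ≤ x ^ 2 / 8 := by
      rw [abs_neg, abs_of_nonneg (by positivity)]
      nlinarith [sq_nonneg x]
    refine (Real.norm_exp_sub_one_sub_id_le (hy.trans (by linarith))).trans ?_
    rw [Real.norm_eq_abs]
    have h4 : |x| ^ 4 ≤ |x| ^ 3 := pow_le_pow_of_le_one hax hx (by norm_num)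
    calc |-(p * (1 - p) * x ^ 2 / 2)| ^ 2 ≤ (x ^ 2 / 8) ^ 2 := by gcongr
      _ = |x| ^ 4 / 64 := by rw [← sq_abs x]; ring
      _ ≤ |x| ^ 3 / 4 := by linarith
  have hsplit : bernoulliCharFun p x - (Real.exp (-(p * (1 - p) * x ^ 2 / 2)) : ℝ) =
      (1 - p : ℝ) * (Complex.exp ((-(p * x) : ℝ) * Complex.I) -
        (1 + (-(p * x) : ℝ) * Complex.I - ((-(p * x) : ℝ) : ℂ) ^ 2 / 2)) +
      (p : ℝ) * (Complex.exp (((1 - p) * x : ℝ) * Complex.I) -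
        (1 + ((1 - p) * x : ℝ) * Complex.I - (((1 - p) * x : ℝ) : ℂ) ^ 2 / 2)) -
      ((Real.exp (-(p * (1 - p) * x ^ 2 / 2)) - 1 - -(p * (1 - p) * x ^ 2 / 2) : ℝ) : ℂ) := by
    unfold bernoulliCharFun
    push_cast
    ring
  rw [hsplit]
  refine (norm_sub_le _ _).trans ?_
  have hadd := norm_add_le
    ((1 - p : ℝ) * (Complex.exp ((-(p * x) : ℝ) * Complex.I) -
        (1 + (-(p * x) : ℝ) * Complex.I - ((-(p * x) : ℝ) : ℂ) ^ 2 / 2)))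
    ((p : ℝ) * (Complex.exp (((1 - p) * x : ℝ) * Complex.I) -
        (1 + ((1 - p) * x : ℝ) * Complex.I - (((1 - p) * x : ℝ) : ℂ) ^ 2 / 2)))
  rw [norm_mul, norm_mul, Complex.norm_real, Complex.norm_real, Real.norm_of_nonneg hp0,
    Real.norm_of_nonneg (by linarith : 0 ≤ 1 - p)] at hadd
  have h1 := mul_le_mul_of_nonneg_left hA (by linarith : 0 ≤ 1 - p)
  have h2 := mul_le_mul_of_nonneg_left hB hp0
  rw [Complex.norm_real, Real.norm_eq_abs]
  nlinarith

theorem norm_bernoulliCharFun_sq (p x : ℝ) :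
    ‖bernoulliCharFun p x‖ ^ 2 = 1 - 2 * (p * (1 - p)) * (1 - Real.cos x) := by
  have hfac : bernoulliCharFun p x = Complex.exp ((-(p * x) : ℝ) * Complex.I) *
      ((1 - p) + p * Complex.exp (x * Complex.I)) := by
    unfold bernoulliCharFun
    rw [mul_add, mul_left_comm, ← Complex.exp_add, mul_comm (Complex.exp _)]
    congr 3
    · push_cast; ring
    · push_cast; ring
  rw [hfac, norm_mul, Complex.norm_exp_ofReal_mul_I, one_mul, ← Complex.normSq_eq_norm_sq,
    Complex.normSq_apply, Complex.exp_mul_I]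
  simp [Complex.cos_ofReal_re, Complex.sin_ofReal_re]
  linear_combination p ^ 2 * Real.sin_sq_add_cos_sq x

theorem norm_bernoulliCharFun_le_exp (p x : ℝ) :
    ‖bernoulliCharFun p x‖ ≤ Real.exp (-(p * (1 - p) * (1 - Real.cos x))) := by
  refine le_of_sq_le_sq ?_ (Real.exp_nonneg _)
  rw [norm_bernoulliCharFun_sq, ← Real.exp_nat_mul]
  have := Real.add_one_le_exp (((2 : ℕ) : ℝ) * -(p * (1 - p) * (1 - Real.cos x)))
  push_cast at this ⊢
  linarith

theorem norm_bernoulliCharFun_le_one {p : ℝ} (hp0 : 0 ≤ p) (hp1 : p ≤ 1) (x : ℝ) :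
    ‖bernoulliCharFun p x‖ ≤ 1 := by
  refine (norm_bernoulliCharFun_le_exp p x).trans (Real.exp_le_one_iff.2 ?_)
  have := mul_nonneg (mul_nonneg hp0 (sub_nonneg.2 hp1)) (sub_nonneg.2 (Real.cos_le_one x))
  linarith

/-- A shift `δ` costs at most `δ ^ 2 / 2` in the quadratic lower bound for `1 - cos`. -/
theorem sq_div_sub_le_one_sub_cos_add {θ : ℝ} (hθ : |θ| ≤ Real.pi) (δ : ℝ) :
    θ ^ 2 / Real.pi ^ 2 - δ ^ 2 / 2 ≤ 1 - Real.cos (θ + δ) := by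
  have h1 := Real.cos_le_one_sub_mul_cos_sq hθ
  have h2 := Real.one_sub_sq_div_two_le_cos (x := δ)
  have hcos (y : ℝ) : Real.cos y = 1 - 2 * Real.sin (y / 2) ^ 2 := by
    have h := Real.cos_two_mul (y / 2)
    rw [mul_div_cancel₀ _ two_ne_zero] at h
    linarith [Real.sin_sq_add_cos_sq (y / 2)]
  have hcosθ := hcos θ
  have hcosA := hcos (θ + δ)
  have hcosB := hcos δ
  have hsub : Real.sin (θ / 2) =
      Real.sin ((θ + δ) / 2) * Real.cos (δ / 2) - Real.cos ((θ + δ) / 2) * Real.sin (δ / 2) := by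
    rw [← Real.sin_sub]
    congr 1
    ring
  have hsq : Real.sin (θ / 2) ^ 2 ≤
      2 * Real.sin ((θ + δ) / 2) ^ 2 + 2 * Real.sin (δ / 2) ^ 2 := by
    have h3 : (Real.sin ((θ + δ) / 2) * Real.cos (δ / 2)) ^ 2 ≤ Real.sin ((θ + δ) / 2) ^ 2 := by
      rw [mul_pow]
      exact mul_le_of_le_one_right (sq_nonneg _) (Real.cos_sq_le_one _)
    have h4 : (Real.cos ((θ + δ) / 2) * Real.sin (δ / 2)) ^ 2 ≤ Real.sin (δ / 2) ^ 2 := by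
      rw [mul_pow]
      exact mul_le_of_le_one_left (sq_nonneg _) (Real.cos_sq_le_one _)
    rw [hsub]
    nlinarith [sq_nonneg (Real.sin ((θ + δ) / 2) * Real.cos (δ / 2) +
      Real.cos ((θ + δ) / 2) * Real.sin (δ / 2))]
  have h5 : 2 / Real.pi ^ 2 * θ ^ 2 = 2 * (θ ^ 2 / Real.pi ^ 2) := by ring
  linarith

/-- Replacing the factors of a product in the unit disc one at a time. -/
theorem norm_prod_sub_prod_le_sum {ι : Type*} (s : Finset ι) (f g : ι → ℂ)
    (hf : ∀ i ∈ s, ‖f i‖ ≤ 1) (hg : ∀ i ∈ s, ‖g i‖ ≤ 1) :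
    ‖∏ i ∈ s, f i - ∏ i ∈ s, g i‖ ≤ ∑ i ∈ s, ‖f i - g i‖ := by
  classical
  induction s using Finset.induction_on with
  | empty => simp
  | insert a s ha ih =>
    rw [Finset.prod_insert ha, Finset.prod_insert ha, Finset.sum_insert ha]
    have hsplit : f a * ∏ i ∈ s, f i - g a * ∏ i ∈ s, g i =
        (f a - g a) * ∏ i ∈ s, f i + g a * (∏ i ∈ s, f i - ∏ i ∈ s, g i) := by ring
    have hprod : ‖∏ i ∈ s, f i‖ ≤ 1 := by
      rw [norm_prod]
      exact Finset.prod_le_one (fun i _ => norm_nonneg _)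
        fun i hi => hf i (Finset.mem_insert_of_mem hi)
    have hrec := ih (fun i hi => hf i (Finset.mem_insert_of_mem hi))
      (fun i hi => hg i (Finset.mem_insert_of_mem hi))
    rw [hsplit]
    refine (norm_add_le _ _).trans ?_
    rw [norm_mul, norm_mul]
    refine add_le_add (mul_le_of_le_one_right (norm_nonneg _) hprod) ?_
    exact (mul_le_of_le_one_left (norm_nonneg _) (hg a (Finset.mem_insert_self a s))).trans hrec

/-! ### Asymptotics of the Fourier integral -/

section Asymptotics

variable {N : ℕ} {p σ : ℝ} {d : Fin N → ℝ}

/-- Gaussian domination of the rescaled integrand on the whole range of integration. -/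
theorem norm_prod_bernoulliCharFun_le {M v : ℝ} (hN : 0 < N) (hp0 : 0 ≤ p) (hp1 : p ≤ 1)
    (hσ0 : 0 < σ) (hσ : σ ^ 2 = N * (p * (1 - p))) (hd : ∀ j, |d j| ≤ M)
    (hv : |v| ≤ Real.pi * σ) :
    ‖∏ j, bernoulliCharFun p ((v + d j) / σ)‖ ≤
      Real.exp (M ^ 2 / 2) * Real.exp (-(Real.pi ^ 2)⁻¹ * v ^ 2) := by
  have hpq0 : 0 ≤ p * (1 - p) := mul_nonneg hp0 (by linarith)
  have hNr : (0 : ℝ) < N := by exact_mod_cast hN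
  have hpq : p * (1 - p) = σ ^ 2 / N := by rw [hσ]; field_simp
  have hvσ : |v / σ| ≤ Real.pi := by
    rw [abs_div, abs_of_pos hσ0, div_le_iff₀ hσ0]
    exact hv
  have hterm (j : Fin N) : ‖bernoulliCharFun p ((v + d j) / σ)‖ ≤
      Real.exp ((M ^ 2 / 2 - (Real.pi ^ 2)⁻¹ * v ^ 2) / N) := by
    refine (norm_bernoulliCharFun_le_exp p _).trans (Real.exp_le_exp.2 ?_)
    rw [add_div]
    have h1 := mul_le_mul_of_nonneg_left (sq_div_sub_le_one_sub_cos_add hvσ (d j / σ)) hpq0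
    have h2 : p * (1 - p) * ((v / σ) ^ 2 / Real.pi ^ 2 - (d j / σ) ^ 2 / 2) =
        ((Real.pi ^ 2)⁻¹ * v ^ 2 - d j ^ 2 / 2) / N := by
      rw [hpq]
      field_simp
    have h3 : d j ^ 2 ≤ M ^ 2 := sq_le_sq' (abs_le.1 (hd j)).1 (abs_le.1 (hd j)).2
    have h4 : -(((Real.pi ^ 2)⁻¹ * v ^ 2 - d j ^ 2 / 2) / N) ≤
        (M ^ 2 / 2 - (Real.pi ^ 2)⁻¹ * v ^ 2) / N := by
      rw [← neg_div]
      gcongr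
      linarith
    linarith
  rw [norm_prod]
  refine (Finset.prod_le_prod (fun j _ => norm_nonneg _) fun j _ => hterm j).trans_eq ?_
  rw [Finset.prod_const, Finset.card_univ, Fintype.card_fin, ← Real.exp_nat_mul,
    mul_div_cancel₀ _ hNr.ne', ← Real.exp_add]
  congr 1
  ring

/-- The rescaled integrand is close to a Gaussian; the cross term of the quadratic form disappears
because `∑ j, d j = 0`. -/
theorem norm_prod_bernoulliCharFun_sub_le {M v : ℝ} (hN : 0 < N) (hp0 : 0 ≤ p) (hp1 : p ≤ 1)
    (hσ0 : 0 < σ) (hσ : σ ^ 2 = N * (p * (1 - p))) (hd : ∀ j, |d j| ≤ M) (hsum : ∑ j, d j = 0)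
    (hv : |v| + M ≤ σ) :
    ‖∏ j, bernoulliCharFun p ((v + d j) / σ) -
        (Real.exp (-((v ^ 2 + (∑ j, d j ^ 2) / N) / 2)) : ℝ)‖ ≤
      N * ((|v| + M) / σ) ^ 3 := by
  have hpq0 : 0 ≤ p * (1 - p) := mul_nonneg hp0 (by linarith)
  have hNr : (0 : ℝ) < N := by exact_mod_cast hN
  have hpq : p * (1 - p) = σ ^ 2 / N := by rw [hσ]; field_simp
  have hgauss : ((Real.exp (-((v ^ 2 + (∑ j, d j ^ 2) / N) / 2)) : ℝ) : ℂ) =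
      ∏ j, ((Real.exp (-(p * (1 - p) * ((v + d j) / σ) ^ 2 / 2)) : ℝ) : ℂ) := by
    rw [← Complex.ofReal_prod, ← Real.exp_sum]
    congr 2
    have hj (j : Fin N) : -(p * (1 - p) * ((v + d j) / σ) ^ 2 / 2) =
        -(v ^ 2 + 2 * v * d j + d j ^ 2) / (2 * N) := by
      rw [hpq]
      field_simp
      ring
    simp_rw [hj, ← Finset.sum_div, Finset.sum_neg_distrib, Finset.sum_add_distrib,
      ← Finset.mul_sum, hsum]
    simp only [Finset.sum_const, Finset.card_univ, Fintype.card_fin, nsmul_eq_mul]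
    field_simp
    ring
  have habs (j : Fin N) : |(v + d j) / σ| ≤ (|v| + M) / σ := by
    rw [abs_div, abs_of_pos hσ0]
    gcongr
    exact (abs_add_le _ _).trans (by gcongr; exact hd j)
  rw [hgauss]
  refine (norm_prod_sub_prod_le_sum _ _ _
    (fun j _ => norm_bernoulliCharFun_le_one hp0 hp1 _) fun j _ => ?_).trans ?_
  · rw [Complex.norm_real, Real.norm_of_nonneg (Real.exp_nonneg _), Real.exp_le_one_iff]
    have := mul_nonneg hpq0 (sq_nonneg ((v + d j) / σ))
    linarith
  · refine (Finset.sum_le_sum fun j _ =>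
      (norm_bernoulliCharFun_sub_exp_le hp0 hp1
        ((habs j).trans ((div_le_one hσ0).2 hv))).trans
        (pow_le_pow_left₀ (abs_nonneg _) (habs j) 3)).trans_eq ?_
    simp

theorem mul_fourierIntegral_div_eq (hσ0 : 0 < σ) :
    σ * fourierIntegral p (fun j => d j / σ) =
      ∫ v, (Set.Ioc (-(Real.pi * σ)) (Real.pi * σ)).indicator
        (fun v => ∏ j, bernoulliCharFun p ((v + d j) / σ)) v := by
  rw [integral_indicator measurableSet_Ioc,
    ← intervalIntegral.integral_of_le (by nlinarith [Real.pi_pos, mul_pos Real.pi_pos hσ0])]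
  have h := intervalIntegral.integral_comp_div (a := -(Real.pi * σ)) (b := Real.pi * σ)
    (fun θ => ∏ j, bernoulliCharFun p (θ + d j / σ)) hσ0.ne'
  rw [neg_div, mul_div_cancel_right₀ _ hσ0.ne', Complex.real_smul] at h
  simp_rw [add_div]
  rw [h, fourierIntegral]

end Asymptotics

/-- Laplace asymptotics of the Fourier integral, in the scale `σ = √(N p (1 - p))`. -/
theorem tendsto_mul_fourierIntegral {N : ℕ → ℕ} {p : ℕ → ℝ} {d : ∀ k, Fin (N k) → ℝ}
    {c M V : ℝ} (hN : Tendsto N atTop atTop) (hp : Tendsto p atTop (𝓝 c)) (hc0 : 0 < c)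
    (hc1 : c < 1) (hsum : ∀ᶠ k in atTop, ∑ j, d k j = 0)
    (hM : ∀ᶠ k in atTop, ∀ j, |d k j| ≤ M)
    (hV : Tendsto (fun k => (∑ j, d k j ^ 2) / N k) atTop (𝓝 V)) :
    Tendsto (fun k => (√(N k * (p k * (1 - p k))) : ℝ) *
        fourierIntegral (p k) (fun j => d k j / √(N k * (p k * (1 - p k))))) atTop
      (𝓝 (∫ v : ℝ, ((Real.exp (-((v ^ 2 + V) / 2)) : ℝ) : ℂ))) := by
  have hpq : Tendsto (fun k => p k * (1 - p k)) atTop (𝓝 (c * (1 - c))) :=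
    hp.mul (tendsto_const_nhds.sub hp)
  have hcc : 0 < c * (1 - c) := mul_pos hc0 (by linarith)
  have hNr : Tendsto (fun k => (N k : ℝ)) atTop atTop := tendsto_natCast_atTop_atTop.comp hN
  have hσ : Tendsto (fun k => √(N k * (p k * (1 - p k)))) atTop atTop :=
    Real.tendsto_sqrt_atTop.comp (hNr.atTop_mul_pos hcc hpq)
  have hev : ∀ᶠ k in atTop, 0 < N k ∧ 0 ≤ p k ∧ p k ≤ 1 ∧
      0 < √(N k * (p k * (1 - p k))) ∧
      √(N k * (p k * (1 - p k))) ^ 2 = N k * (p k * (1 - p k)) := by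
    filter_upwards [hN.eventually_gt_atTop 0, hp.eventually_const_lt hc0,
      hp.eventually_lt_const hc1, hσ.eventually_gt_atTop 0] with k h1 h2 h3 h4
    exact ⟨h1, h2.le, h3.le, h4, Real.sq_sqrt (Real.sqrt_pos.1 h4).le⟩
  refine Tendsto.congr' (f₁ := fun k => ∫ v, (Set.Ioc (-(Real.pi * √(N k * (p k * (1 - p k)))))
    (Real.pi * √(N k * (p k * (1 - p k))))).indicator
      (fun v => ∏ j, bernoulliCharFun (p k) ((v + d k j) / √(N k * (p k * (1 - p k))))) v) ?_ ?_
  · filter_upwards [hev] with k hk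
    exact (mul_fourierIntegral_div_eq hk.2.2.2.1).symm
  refine tendsto_integral_filter_of_dominated_convergence
    (fun v => Real.exp (M ^ 2 / 2) * Real.exp (-(Real.pi ^ 2)⁻¹ * v ^ 2)) ?_ ?_ ?_ ?_
  · refine .of_forall fun k => AEStronglyMeasurable.indicator ?_ measurableSet_Ioc
    exact Continuous.aestronglyMeasurable (by fun_prop)
  · filter_upwards [hev, hM] with k hk hMk
    refine .of_forall fun v => ?_
    refine (norm_indicator_eq_indicator_norm _ _).trans_le (Set.indicator_apply_le' (fun hv => ?_)
      fun _ => by positivity)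
    exact norm_prod_bernoulliCharFun_le hk.1 hk.2.1 hk.2.2.1 hk.2.2.2.1 hk.2.2.2.2 hMk
      (abs_le.2 ⟨hv.1.le, hv.2⟩)
  · exact (integrable_exp_neg_mul_sq (by positivity)).const_mul _
  · refine .of_forall fun v => ?_
    have hexp : Tendsto (fun k => ((Real.exp (-((v ^ 2 + (∑ j, d k j ^ 2) / N k) / 2)) : ℝ) : ℂ))
        atTop (𝓝 ((Real.exp (-((v ^ 2 + V) / 2)) : ℝ) : ℂ)) := by
      refine (Complex.continuous_ofReal.tendsto _).comp ((Real.continuous_exp.tendsto _).comp ?_)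
      exact ((tendsto_const_nhds.add hV).div_const 2).neg
    -- `N / σ ^ 3 = 1 / (p (1 - p) σ)`
    have herr : Tendsto (fun k => N k * ((|v| + M) / √(N k * (p k * (1 - p k)))) ^ 3) atTop
        (𝓝 0) := by
      have h0 : Tendsto (fun k => (|v| + M) ^ 3 / (p k * (1 - p k)) /
          √(N k * (p k * (1 - p k)))) atTop (𝓝 0) :=
        (tendsto_const_nhds.div hpq hcc.ne').div_atTop hσ
      refine h0.congr' ?_
      filter_upwards [hev, hpq.eventually_const_lt hcc] with k hk hk'
      obtain ⟨hN0, -, -, hs0, hs2⟩ := hk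
      have hN0' : (0 : ℝ) < N k := by exact_mod_cast hN0
      rw [div_pow, pow_succ (√_) 2, hs2]
      field_simp
    have hdiff : Tendsto (fun k => (Set.Ioc (-(Real.pi * √(N k * (p k * (1 - p k)))))
          (Real.pi * √(N k * (p k * (1 - p k))))).indicator
        (fun v => ∏ j, bernoulliCharFun (p k) ((v + d k j) / √(N k * (p k * (1 - p k))))) v -
          ((Real.exp (-((v ^ 2 + (∑ j, d k j ^ 2) / N k) / 2)) : ℝ) : ℂ)) atTop (𝓝 0) := by
      refine squeeze_zero_norm' ?_ herr
      filter_upwards [hev, hM, hsum, hσ.eventually_ge_atTop (|v| + M),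
        hσ.eventually_gt_atTop |v|] with k hk hMk hsk hvM hv
      have hπσ : √(N k * (p k * (1 - p k))) ≤ Real.pi * √(N k * (p k * (1 - p k))) :=
        le_mul_of_one_le_left hk.2.2.2.1.le (by linarith [Real.pi_gt_three])
      rw [Set.indicator_of_mem (Set.mem_Ioc.2
        ⟨by linarith [neg_abs_le v], by linarith [le_abs_self v]⟩)]
      exact norm_prod_bernoulliCharFun_sub_le hk.1 hk.2.1 hk.2.2.1 hk.2.2.2.1 hk.2.2.2.2 hMk hsk
        hvM
    simpa using hdiff.add hexp

/-- The normalization `∫ exp (-v² / 2)` and the scale `σ` cancel in the ratio. -/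
theorem tendsto_fourierIntegral_div {N : ℕ → ℕ} {p : ℕ → ℝ} {d : ∀ k, Fin (N k) → ℝ}
    {c M V : ℝ} (hN : Tendsto N atTop atTop) (hp : Tendsto p atTop (𝓝 c)) (hc0 : 0 < c)
    (hc1 : c < 1) (hsum : ∀ᶠ k in atTop, ∑ j, d k j = 0)
    (hM : ∀ᶠ k in atTop, ∀ j, |d k j| ≤ M)
    (hV : Tendsto (fun k => (∑ j, d k j ^ 2) / N k) atTop (𝓝 V)) :
    Tendsto (fun k => fourierIntegral (p k) (fun j => d k j / √(N k * (p k * (1 - p k)))) /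
        fourierIntegral (p k) (fun _ : Fin (N k) => 0)) atTop
      (𝓝 ((Real.exp (-(V / 2)) : ℝ) : ℂ)) := by
  have hnum := tendsto_mul_fourierIntegral hN hp hc0 hc1 hsum hM hV
  have hden := tendsto_mul_fourierIntegral (d := fun k (_ : Fin (N k)) => (0 : ℝ)) (M := 0)
    (V := 0) hN hp hc0 hc1 (by simp) (by simp) (by simp)
  simp only [integral_complex_ofReal, zero_div, add_zero] at hnum hden
  have hden0 : 0 < ∫ v : ℝ, Real.exp (-(v ^ 2 / 2)) := by
    have h : ∀ v : ℝ, -(v ^ 2 / 2) = -(1 / 2) * v ^ 2 := fun v => by ring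
    simp_rw [h, integral_gaussian]
    positivity
  have hfac : ∫ v : ℝ, Real.exp (-((v ^ 2 + V) / 2)) =
      Real.exp (-(V / 2)) * ∫ v : ℝ, Real.exp (-(v ^ 2 / 2)) := by
    rw [← integral_const_mul]
    refine integral_congr_ae (.of_forall fun v => ?_)
    change Real.exp _ = Real.exp _ * Real.exp _
    rw [← Real.exp_add]
    congr 1
    ring
  have hratio := hnum.div hden (by exact_mod_cast hden0.ne')
  rw [hfac, Complex.ofReal_mul, mul_div_cancel_right₀ _ (by exact_mod_cast hden0.ne')] at hratio
  refine hratio.congr' ?_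
  filter_upwards [hN.eventually_gt_atTop 0, hp.eventually_const_lt hc0,
    hp.eventually_lt_const hc1] with k h1 h2 h3
  have hσ : 0 < √(N k * (p k * (1 - p k))) :=
    Real.sqrt_pos.2 (mul_pos (by exact_mod_cast h1) (mul_pos h2 (by linarith)))
  exact mul_div_mul_left _ _ (by exact_mod_cast hσ.ne')

/-! ### Asymptotic normality of the difference in means -/

theorem sq_sub_popMean_le_of_hajekRatio_le {N : ℕ} {x : Fin N → ℝ} {B : ℝ}
    (hpos : 0 < ∑ i, (x i - popMean x) ^ 2) (hB : hajekRatio x ≤ B) (i : Fin N) :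
    (x i - popMean x) ^ 2 ≤ B * ((∑ i, (x i - popMean x) ^ 2) / N) := by
  have hN : (0 : ℝ) < N := by exact_mod_cast i.pos
  have hsup := le_ciSup (f := fun i => (x i - popMean x) ^ 2) (Set.finite_range _).bddAbove i
  exact hsup.trans ((div_le_iff₀ (div_pos hpos hN)).1 hB)

/-- The characteristic function of the standardized estimator, as a ratio of Fourier integrals.
The free factor `σ` puts the weights into the form that `tendsto_fourierIntegral_div` expects: for
`σ = √(N p (1 - p))` and `S` the standard deviation of the estimator, the numbers
`u * (σ / S) * (x j - x̄)` have sum of squares `u ^ 2 * (N - 1)`. -/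
theorem IsCompletelyRandomized.charFun_standardized_tauHat {N N₁ : ℕ} {Ω : Type*}
    [MeasurableSpace Ω] {P : Measure Ω} [IsProbabilityMeasure P] {T : Ω → Assignment N}
    (h : IsCompletelyRandomized N₁ T P) (Y : PotentialOutcomes N) (h0 : 0 < N₁) (h1 : N₁ < N)
    {σ : ℝ} (hσ : σ ≠ 0) (S u : ℝ) :
    charFun (P.map fun ω => (tauHat N₁ Y (T ω) - avgEffect Y) / S) u =
      fourierIntegral ((N₁ : ℝ) / N) (fun j => u * (σ / S) *
          (weightedOutcome N₁ Y j - popMean (weightedOutcome N₁ Y)) / σ) /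
        fourierIntegral ((N₁ : ℝ) / N) (fun _ : Fin N => 0) := by
  have hsum : ∑ j, u * (σ / S) *
      (weightedOutcome N₁ Y j - popMean (weightedOutcome N₁ Y)) / σ = 0 := by
    rw [← Finset.sum_div, ← Finset.mul_sum, sum_sub_popMean, mul_zero, zero_div]
  have hmeas : AEMeasurable (fun ω => (tauHat N₁ Y (T ω) - avgEffect Y) / S) P :=
    (h.integrable_comp fun t => (tauHat N₁ Y t - avgEffect Y) / S).aestronglyMeasurable.aemeasurable
  rw [← h.integral_exp_linear h0 h1 hsum, charFun_apply_real,
    integral_map hmeas (Continuous.aestronglyMeasurable (by fun_prop))]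
  refine h.integral_comp_congr
    (f := fun t => Complex.exp (u * ((tauHat N₁ Y t - avgEffect Y) / S : ℝ) * Complex.I))
    (g := fun t => Complex.exp ((∑ j, ((t j : ℕ) : ℝ) * (u * (σ / S) *
      (weightedOutcome N₁ Y j - popMean (weightedOutcome N₁ Y)) / σ) : ℝ) * Complex.I))
    fun t ht => ?_
  rw [← Complex.ofReal_mul, tauHat_sub_avgEffect Y h0 h1 ht, Finset.sum_div, Finset.mul_sum]
  congr 3
  refine Finset.sum_congr rfl fun j _ => ?_
  field_simp

theorem tendsto_charFun_standardized_tauHat {N N₁ : ℕ → ℕ} (Y : ∀ k, PotentialOutcomes (N k))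
    {Ω : ℕ → Type*} [∀ k, MeasurableSpace (Ω k)] (P : ∀ k, Measure (Ω k))
    [∀ k, IsProbabilityMeasure (P k)] {T : ∀ k, Ω k → Assignment (N k)} {c : ℝ}
    (hT : ∀ k, IsCompletelyRandomized (N₁ k) (T k) (P k)) (hN : Tendsto N atTop atTop)
    (hc0 : 0 < c) (hc1 : c < 1)
    (hc : Tendsto (fun k => (N₁ k : ℝ) / (N k : ℝ)) atTop (𝓝 c))
    (hH : HajekCondition (fun k => weightedOutcome (N₁ k) (Y k))) (u : ℝ) :
    Tendsto (fun k => charFun ((P k).map fun ω =>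
        (tauHat (N₁ k) (Y k) (T k ω) - avgEffect (Y k)) /
          √(variance (fun ω' => tauHat (N₁ k) (Y k) (T k ω')) (P k))) u) atTop
      (𝓝 ((Real.exp (-(u ^ 2 / 2)) : ℝ) : ℂ)) := by
  obtain ⟨B, hB⟩ := hH
  set x := fun k => weightedOutcome (N₁ k) (Y k) with hx
  set σ := fun k => √(N k * ((N₁ k : ℝ) / N k * (1 - (N₁ k : ℝ) / N k))) with hσdef
  set S := fun k => √(variance (fun ω' => tauHat (N₁ k) (Y k) (T k ω')) (P k)) with hS
  have hev : ∀ᶠ k in atTop, 0 < N₁ k ∧ N₁ k < N k := by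
    filter_upwards [hN.eventually_gt_atTop 0, hc.eventually_const_lt hc0,
      hc.eventually_lt_const hc1] with k h1 h2 h3
    have hNk : (0 : ℝ) < N k := by exact_mod_cast h1
    rw [div_lt_one hNk] at h3
    refine ⟨Nat.pos_of_ne_zero fun h => ?_, by exact_mod_cast h3⟩
    simp [h] at h2
  -- `σ² / var(τ̂) = (N - 1) / ∑ i, (x i - x̄)²`
  have hratio : ∀ᶠ k in atTop, 0 < σ k ∧ (σ k / S k) ^ 2 =
      ((N k : ℝ) - 1) / ∑ i, (x k i - popMean (x k)) ^ 2 := by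
    filter_upwards [hev, hB] with k hk hBk
    have h1 : (0 : ℝ) < N₁ k := by exact_mod_cast hk.1
    have h2 : (N₁ k : ℝ) < N k := by exact_mod_cast hk.2
    have h3 : (0 : ℝ) < N k - 1 := sub_pos.2 (by exact_mod_cast (by omega : 1 < N k))
    have h4 : (0 : ℝ) < N k - N₁ k := sub_pos.2 h2
    have h5 : (0 : ℝ) < N k := h1.trans h2
    have hA := hBk.1
    have hv : (N k : ℝ) * ((N₁ k : ℝ) / N k * (1 - (N₁ k : ℝ) / N k)) =
        (N₁ k : ℝ) * (N k - N₁ k) / N k := by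
      field_simp
    have hv0 : 0 < (N₁ k : ℝ) * (N k - N₁ k) / N k := by positivity
    refine ⟨Real.sqrt_pos.2 (hv ▸ hv0), ?_⟩
    rw [div_pow, hσdef, hS]
    dsimp only
    rw [Real.sq_sqrt (hv ▸ hv0.le), Real.sq_sqrt (variance_nonneg _ _), hv,
      (hT k).variance_tauHat (Y k) hk.1 hk.2]
    change 0 < ∑ i, (x k i - popMean (x k)) ^ 2 at hA
    change _ / (_ * ∑ i, (x k i - popMean (x k)) ^ 2) = _
    field_simp
  have hlim := tendsto_fourierIntegral_div
    (d := fun k j => u * (σ k / S k) * (x k j - popMean (x k))) (M := √(u ^ 2 * B)) (V := u ^ 2)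
    hN hc hc0 hc1 ?_ ?_ ?_
  · refine hlim.congr' ?_
    filter_upwards [hev, hratio] with k hk hk'
    exact ((hT k).charFun_standardized_tauHat (Y k) hk.1 hk.2 hk'.1.ne' (S k) u).symm
  · refine .of_forall fun k => ?_
    rw [← Finset.mul_sum, sum_sub_popMean, mul_zero]
  · filter_upwards [hev, hratio, hB] with k hk hk' hBk j
    refine Real.abs_le_sqrt ?_
    have hA := hBk.1
    have hj := sq_sub_popMean_le_of_hajekRatio_le hBk.1 hBk.2 j
    have h5 : (1 : ℝ) ≤ N k := by exact_mod_cast (by omega : 1 ≤ N k)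
    change 0 < ∑ i, (x k i - popMean (x k)) ^ 2 at hA
    change (x k j - popMean (x k)) ^ 2 ≤ B * ((∑ i, (x k i - popMean (x k)) ^ 2) / N k) at hj
    have hB0 : 0 ≤ B := by
      have hq : 0 < (∑ i, (x k i - popMean (x k)) ^ 2) / (N k : ℝ) := by positivity
      exact nonneg_of_mul_nonneg_left ((sq_nonneg _).trans hj) hq
    rw [mul_pow, mul_pow, hk'.2, mul_assoc]
    refine mul_le_mul_of_nonneg_left ?_ (sq_nonneg u)
    have hq : 0 ≤ ((N k : ℝ) - 1) / ∑ i, (x k i - popMean (x k)) ^ 2 :=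
      div_nonneg (by linarith) hA.le
    refine (mul_le_mul_of_nonneg_left hj hq).trans ?_
    calc ((N k : ℝ) - 1) / (∑ i, (x k i - popMean (x k)) ^ 2) *
          (B * ((∑ i, (x k i - popMean (x k)) ^ 2) / N k))
        = B * (((N k : ℝ) - 1) / N k) := by field_simp
      _ ≤ B := mul_le_of_le_one_right hB0 ((div_le_one (by linarith)).2 (by linarith))
  · have h1 : Tendsto (fun k => u ^ 2 * (1 - 1 / (N k : ℝ))) atTop (𝓝 (u ^ 2)) := by
      simpa using (tendsto_const_nhds (x := u ^ 2)).mul ((tendsto_const_nhds (x := (1 : ℝ))).sub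
        (tendsto_one_div_atTop_nhds_zero_nat.comp hN))
    refine h1.congr' ?_
    filter_upwards [hev, hratio, hB] with k hk hk' hBk
    have hA := hBk.1
    change 0 < ∑ i, (x k i - popMean (x k)) ^ 2 at hA
    have h5 : (0 : ℝ) < N k := by exact_mod_cast (by omega : 0 < N k)
    simp_rw [mul_pow, hk'.2, ← Finset.mul_sum]
    field_simp

theorem theorem1 :
    -- exact mean and variance in every completely randomized experiment
    (∀ (N N₁ : ℕ) (Y : PotentialOutcomes N) (Ω : Type*) [MeasurableSpace Ω]
        (P : Measure Ω) [IsProbabilityMeasure P] (T : Ω → Assignment N),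
        0 < N₁ → N₁ < N → IsCompletelyRandomized N₁ T P →
        MemLp (fun ω => tauHat N₁ Y (T ω)) 2 P ∧
        ∫ ω, tauHat N₁ Y (T ω) ∂P = avgEffect Y ∧
        variance (fun ω => tauHat N₁ Y (T ω)) P =
          popVar (fun i => Y i 1) / (armSize N N₁ 1 : ℝ) +
            popVar (fun i => Y i 0) / (armSize N N₁ 0 : ℝ) -
            popVar (indivEffect Y) / (N : ℝ)) ∧
    -- asymptotic normality along sequences of completely randomized experiments
    (∀ (N N₁ : ℕ → ℕ) (Y : ∀ k, PotentialOutcomes (N k)) (Ω : ℕ → Type*)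
        [∀ k, MeasurableSpace (Ω k)] (P : ∀ k, Measure (Ω k))
        [∀ k, IsProbabilityMeasure (P k)] (T : ∀ k, Ω k → Assignment (N k)) (c : ℝ),
        (∀ k, IsCompletelyRandomized (N₁ k) (T k) (P k)) →
        Tendsto N atTop atTop →
        0 < c → c < 1 →
        Tendsto (fun k => (N₁ k : ℝ) / (N k : ℝ)) atTop (𝓝 c) →
        HajekCondition (fun k => weightedOutcome (N₁ k) (Y k)) →
        TendstoInDistribution
          (fun k ω => (tauHat (N₁ k) (Y k) (T k ω) - avgEffect (Y k)) /
            √(variance (fun ω' => tauHat (N₁ k) (Y k) (T k ω')) (P k)))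
          atTop (id : ℝ → ℝ) P (gaussianReal 0 1)) := by
  constructor
  · intro N N₁ Y Ω _ P _ T h0 h1 h
    exact ⟨h.memLp_comp _ 2, h.integral_tauHat Y h0 h1,
      (h.variance_tauHat Y h0 h1).trans (sum_sq_weightedOutcome_eq Y h0 h1)⟩
  · intro N N₁ Y Ω _ P _ T c hT hN hc0 hc1 hc hH
    refine ⟨fun k => ((hT k).integrable_comp fun t => (tauHat (N₁ k) (Y k) t - avgEffect (Y k)) /
      √(variance (fun ω' => tauHat (N₁ k) (Y k) (T k ω')) (P k))).aestronglyMeasurable.aemeasurable,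
      aemeasurable_id, ProbabilityMeasure.tendsto_iff_tendsto_charFun.2 fun u => ?_⟩
    have hlim := tendsto_charFun_standardized_tauHat Y P hT hN hc0 hc1 hc hH u
    have hgauss : charFun ((gaussianReal 0 1).map id) u = ((Real.exp (-(u ^ 2 / 2)) : ℝ) : ℂ) := by
      rw [Measure.map_id, charFun_gaussianReal]
      push_cast
      congr 1
      simp
    rw [← hgauss] at hlim
    exact hlim
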